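/- Let $n\ge 1$ be an integer, let $\alpha\ge 1$ be an integer, and let $C>0$, $\sigma>0$. Consider $n$ i.i.d. observations $(Y_i,X_i)\in\mathbb R\times[0,1]$ from the model $Y_i=f(X_i)+\xi_i$, with $X_i\sim U[0,1]$ and $\xi_i\sim N(0,\sigma^2)$ independent of $X_i$. The function $f$ belongs to the periodic Sobolev class $\tilde W(\alpha,C)$ of all $f:[0,1]\to\mathbb R$ that are $\alpha-1$ times continuously differentiable with $f^{(\alpha-1)}$ absolutely continuous, $f^{(j)}(0)=f^{(j)}(1)$ for $0\le j\le\alpha-1$, and $\int_0^1 (f^{(\alpha)}(x))^2\,dx\le C^2$. Let $\mathcal M_{\varepsilon,\delta}$ be the set of all $(\varepsilon,\delta)$-differentially private randomized estimators, that is, Markov kernels $\hat f$ from $(\mathbb R\times[0,1])^n$ to $L^2[0,1]$ (with its Borel $\sigma$-algebra) such that $$\mathbb P(\hat f(D)\in S)\le e^{\varepsilon}\,\mathbb P(\hat f(D')\in S)+\delta$$ for all data sets $D,D'$ that differ in at most one observation and all measurable $S$. Then there is a universal constant $c>0$ such that for all $\alpha,C,\sigma$ as above and every $a>0$ there is a constant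 $c'>0$, depending only on $\alpha,C,\sigma,a$, such that for all $n\ge1$, $0<\varepsilon<1$ and $0<\delta<c\,n^{-2}$ with $n\varepsilon\ge a$, $$\inf_{\hat f\in\mathcal M_{\varepsilon,\delta}}\ \sup_{f\in\tilde W(\alpha,C)}\ \mathbb E\left[\int_0^1\big(\hat f(x)-f(x)\big)^2\,dx\right]\ \ge\ c'\left(n^{-\frac{2\alpha}{2\alpha+1}}+(n\varepsilon)^{-\frac{2\alpha}{\alpha+1}}\right),$$ where the expectation is over the data and the randomness of $\hat f$, and takes values in $[0,\infty]$. -/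

import Mathlib

open MeasureTheory ProbabilityTheory Set
open scoped NNReal ENNReal

noncomputable section

namespace PrivateRegression

/-- The periodic Sobolev class of order `α ≥ 1` and radius `C` on `[0, 1]`: functions whose
derivative of order `α - 1` is absolutely continuous on `[0, 1]`, whose derivatives of orders
`0, …, α - 1` agree at the two endpoints, and whose derivative of order `α` (which exists almost
everywhere) is square integrable with `∫₀¹ (f^(α))² ≤ C²`. All derivatives are taken within
`[0, 1]`, so that the values of `f` outside `[0, 1]` play no role. -/
def periodicSobolev (α : ℕ) (C : ℝ) : Set (ℝ → ℝ) :=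
  {f | ContDiffOn ℝ ((α - 1 : ℕ) : WithTop ℕ∞) f (Icc 0 1) ∧
    AbsolutelyContinuousOnInterval (iteratedDerivWithin (α - 1) f (Icc 0 1)) 0 1 ∧
    (∀ j < α, iteratedDerivWithin j f (Icc 0 1) 0 = iteratedDerivWithin j f (Icc 0 1) 1) ∧
    MemLp (iteratedDerivWithin α f (Icc 0 1)) 2 (volume.restrict (Icc 0 1)) ∧
    ∫ x in (0 : ℝ)..1, (iteratedDerivWithin α f (Icc 0 1) x) ^ 2 ≤ C ^ 2}

/-- One observation `(Y, X)` with response `Y ∈ ℝ` and design point `X ∈ [0, 1]`. -/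
abbrev Datum : Type := ℝ × unitInterval

/-- An ordered data set of `n` observations. -/
abbrev Dataset (n : ℕ) : Type := Fin n → Datum

/-- The law of `(Y, X)` where `Y = f(X) + ξ`, `X ∼ U[0, 1]`, and `ξ ∼ N(0, σ²)` is independent
of `X`. -/
def datumLaw (f : ℝ → ℝ) (σ : ℝ≥0) : Measure Datum :=
  ((volume : Measure unitInterval).prod (gaussianReal 0 (σ ^ 2))).map
    (fun p => (f p.1 + p.2, p.1))

/-- The law of `n` independent observations. -/
def dataLaw (n : ℕ) (f : ℝ → ℝ) (σ : ℝ≥0) : Measure (Dataset n) :=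
  Measure.pi fun _ => datumLaw f σ

/-- The space `L²[0, 1]` of values of an estimator of the regression function. -/
abbrev L2Unit : Type := Lp ℝ 2 (volume : Measure unitInterval)

/-- `L²[0, 1]` carries its Borel σ-algebra. -/
instance instMeasurableSpaceL2Unit : MeasurableSpace L2Unit := borel L2Unit

instance instBorelSpaceL2Unit : BorelSpace L2Unit := ⟨rfl⟩

/-- Two data sets are adjacent if they differ in at most one observation, at the same position. -/
def Adjacent {n : ℕ} (D D' : Dataset n) : Prop :=
  ∃ i, ∀ j, j ≠ i → D j = D' j

/-- `(ε, δ)`-differential privacy of a randomized algorithm, which is a kernel that sends a data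
set to the law of the output given that data set. -/
def IsDP {n : ℕ} {R : Type*} [MeasurableSpace R] (ε δ : ℝ) (M : Kernel (Dataset n) R) : Prop :=
  ∀ D D' : Dataset n, Adjacent D D' → ∀ S : Set R, MeasurableSet S →
    M D S ≤ ENNReal.ofReal (Real.exp ε) * M D' S + ENNReal.ofReal δ

/-- The `(ε, δ)`-differentially private randomized estimators of the regression function. -/
def privateEstimators (n : ℕ) (ε δ : ℝ) : Set (Kernel (Dataset n) L2Unit) :=
  {M | IsMarkovKernel M ∧ IsDP ε δ M}

/-- The mean integrated squared error of the randomized estimator `M` at the regression function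
`f`, with values in `[0, ∞]`. The expectation is over the data and the randomness of `M`. -/
def mise {n : ℕ} (σ : ℝ≥0) (M : Kernel (Dataset n) L2Unit) (f : ℝ → ℝ) : ℝ≥0∞ :=
  ∫⁻ D, (∫⁻ g, (∫⁻ x : unitInterval, ENNReal.ofReal ((g x - f x) ^ 2)) ∂(M D)) ∂(dataLaw n f σ)

/-- The privacy-constrained minimax risk over the periodic Sobolev class. -/
def minimaxRisk (n α : ℕ) (C : ℝ) (σ : ℝ≥0) (ε δ : ℝ) : ℝ≥0∞ :=
  ⨅ M ∈ privateEstimators n ε δ, ⨆ f ∈ periodicSobolev α C, mise σ M f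

end PrivateRegression

end

/-!
A function that is a sum of `m` disjoint bumps of width `1 / m` and height of order `m ^ (-α)` lies
in the Sobolev ball, and switching single bumps on and off yields a hypercube of such functions,
whose edges have `L²` length of order `m ^ (-(2 * α + 1) / 2)`. By Assouad's lemma the risk is at
least of order `m ^ (-2 * α)` as soon as no test can tell the two ends of an edge apart from the
output of the estimator.

Flipping a bump changes the law of a response only when the design point falls into one cell of
length `1 / m`. Hence `χ²` between the laws of one observation is of order `m ^ (-(2 * α + 1))`, and
the `n` observations carry too little information about an edge when `m ^ (2 * α + 1)` is of order
`n`. The total variation distance between these laws is of order `m ^ (-(α + 1))`. Resampling the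
data one observation at a time, each step changes the output probabilities of a private estimator by
at most `exp ε - 1 + δ` times this distance, so the output carries too little information about an
edge when `m ^ (α + 1)` is of order `n * ε`.
-/

namespace PrivateRegression

open scoped ContDiff InnerProductSpace

theorem sq_lintegral_le_mul {X : Type*} [MeasurableSpace X] {μ : Measure X} {A E B : X → ℝ≥0∞}
    (hE : Measurable E) (hB : Measurable B) (h : ∀ x, A x ^ 2 ≤ E x * B x) :
    (∫⁻ x, A x ∂μ) ^ 2 ≤ (∫⁻ x, E x ∂μ) * ∫⁻ x, B x ∂μ := by
  have sq_sqrt (t : ℝ≥0∞) : (t ^ (2⁻¹ : ℝ)) ^ 2 = t := by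
    simpa using ENNReal.rpow_inv_natCast_pow two_ne_zero t
  calc (∫⁻ x, A x ∂μ) ^ 2
      ≤ (∫⁻ x, E x ^ (2⁻¹ : ℝ) * B x ^ (2⁻¹ : ℝ) ∂μ) ^ 2 := by
        gcongr with x
        refine (ENNReal.pow_le_pow_left_iff two_ne_zero).1 ?_
        rw [mul_pow, sq_sqrt, sq_sqrt]
        exact h x
    _ ≤ ((∫⁻ x, E x ∂μ) ^ (2⁻¹ : ℝ) * (∫⁻ x, B x ∂μ) ^ (2⁻¹ : ℝ)) ^ 2 := by
        gcongr
        simpa [sq_sqrt] using ENNReal.lintegral_mul_le_Lp_mul_Lq μ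
          Real.HolderConjugate.two_two (hE.pow_const (2⁻¹ : ℝ)).aemeasurable
          (hB.pow_const (2⁻¹ : ℝ)).aemeasurable
    _ = (∫⁻ x, E x ∂μ) * ∫⁻ x, B x ∂μ := by rw [mul_pow, sq_sqrt, sq_sqrt]

section Divergences

variable {X : Type*} [MeasurableSpace X] {P Q : Measure X} {ρ τ : ℝ≥0∞}

/-- The bound `1 + χ²(P ‖ Q) ≤ ρ` on the chi-square divergence. It is stated in its variational
form, which makes sense without densities and tensorizes by Fubini. -/
def ChiSqLE (ρ : ℝ≥0∞) (P Q : Measure X) : Prop :=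
  ∀ u : X → ℝ≥0∞, Measurable u → (∫⁻ x, u x ∂P) ^ 2 ≤ ρ * ∫⁻ x, u x ^ 2 ∂Q

/-- The bound `TV(P, Q) ≤ τ` on the total variation distance of two probability measures. It is
stated in its variational form, where the oscillation of the test function is at most `K`. -/
def TVLE (τ : ℝ≥0∞) (P Q : Measure X) : Prop :=
  ∀ (u : X → ℝ≥0∞) (K : ℝ≥0∞), Measurable u → (∀ x y, u x ≤ u y + K) →
    ∫⁻ x, u x ∂P ≤ ∫⁻ x, u x ∂Q + K * τ

theorem ChiSqLE.mono {ρ' : ℝ≥0∞} (h : ChiSqLE ρ P Q) (hρ : ρ ≤ ρ') : ChiSqLE ρ' P Q :=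
  fun u hu => (h u hu).trans (by gcongr)

theorem TVLE.mono {τ' : ℝ≥0∞} (h : TVLE τ P Q) (hτ : τ ≤ τ') : TVLE τ' P Q :=
  fun u K hu hK => (h u K hu hK).trans (by gcongr)

theorem chiSqLE_withDensity {w : X → ℝ≥0∞} (hw : Measurable w) (h : ∫⁻ x, w x ^ 2 ∂Q ≤ ρ) :
    ChiSqLE ρ (Q.withDensity w) Q := fun u hu => by
  rw [lintegral_withDensity_eq_lintegral_mul Q hw hu]
  exact (sq_lintegral_le_mul (hw.pow_const 2) (hu.pow_const 2) fun x => (mul_pow _ _ 2).le).trans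
    (by gcongr)

theorem tsub_one_sq_add_two_mul_le (w : ℝ≥0∞) : (w - 1) ^ 2 + 2 * w ≤ w ^ 2 + 1 := by
  rcases le_total w 1 with h | h
  · lift w to ℝ≥0 using ne_top_of_le_ne_top ENNReal.one_ne_top h
    rw [tsub_eq_zero_of_le h]
    norm_cast
    simpa using two_mul_le_add_sq w 1
  · obtain ⟨t, rfl⟩ := exists_add_of_le h
    rw [ENNReal.add_sub_cancel_left ENNReal.one_ne_top]
    exact le_of_eq (by ring)

theorem lintegral_tsub_one_le [IsProbabilityMeasure Q] {w : X → ℝ≥0∞} (hw : Measurable w)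
    (hw1 : ∫⁻ x, w x ∂Q = 1) (h : ∫⁻ x, w x ^ 2 ∂Q ≤ 1 + τ ^ 2) :
    ∫⁻ x, (w x - 1) ∂Q ≤ τ := by
  have hw' : Measurable fun x => w x - 1 := hw.sub_const 1
  have second_moment : ∫⁻ x, (w x - 1) ^ 2 ∂Q + 2 ≤ τ ^ 2 + 2 :=
    calc ∫⁻ x, (w x - 1) ^ 2 ∂Q + 2 = ∫⁻ x, ((w x - 1) ^ 2 + 2 * w x) ∂Q := by
          rw [lintegral_add_left (hw'.pow_const 2), lintegral_const_mul _ hw, hw1, mul_one]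
      _ ≤ ∫⁻ x, (w x ^ 2 + 1) ∂Q := lintegral_mono fun x => tsub_one_sq_add_two_mul_le (w x)
      _ = ∫⁻ x, w x ^ 2 ∂Q + 1 := by simp [lintegral_add_left (hw.pow_const 2)]
      _ ≤ 1 + τ ^ 2 + 1 := by gcongr
      _ = τ ^ 2 + 2 := by ring
  refine (ENNReal.pow_le_pow_left_iff two_ne_zero).1 ?_
  calc (∫⁻ x, (w x - 1) ∂Q) ^ 2 ≤ (∫⁻ x, (w x - 1) ^ 2 ∂Q) * ∫⁻ _, 1 ∂Q :=
        sq_lintegral_le_mul (hw'.pow_const 2) measurable_const fun x => (mul_one _).ge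
    _ ≤ τ ^ 2 := by simpa using (ENNReal.add_le_add_iff_right ENNReal.ofNat_ne_top).1 second_moment

theorem tvLE_withDensity [IsProbabilityMeasure Q] {w : X → ℝ≥0∞}
    [IsProbabilityMeasure (Q.withDensity w)] (hw : Measurable w) (h : ∫⁻ x, (w x - 1) ∂Q ≤ τ) :
    TVLE τ (Q.withDensity w) Q := by
  intro u K hu hK
  set b := ⨅ x, u x
  have hub : ∀ x, u x = b + (u x - b) := fun x => (add_tsub_cancel_of_le (iInf_le u x)).symm
  have hvK : ∀ x, u x - b ≤ K := fun x =>
    tsub_le_iff_tsub_le.1 (le_iInf fun y => tsub_le_iff_right.2 (hK x y))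
  have hv : Measurable fun x => u x - b := hu.sub_const b
  have integral_eq : ∀ ν : Measure X, IsProbabilityMeasure ν →
      ∫⁻ x, u x ∂ν = b + ∫⁻ x, (u x - b) ∂ν := fun ν _ => by
    rw [lintegral_congr hub, lintegral_add_left measurable_const]
    simp
  calc ∫⁻ x, u x ∂Q.withDensity w = b + ∫⁻ x, w x * (u x - b) ∂Q := by
        rw [integral_eq _ ‹_›, lintegral_withDensity_eq_lintegral_mul Q hw hv]
        rfl
    _ ≤ b + ∫⁻ x, ((u x - b) + K * (w x - 1)) ∂Q := by
        gcongr with x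
        calc w x * (u x - b) ≤ (1 + (w x - 1)) * (u x - b) := by gcongr; exact le_add_tsub
          _ = (u x - b) + (u x - b) * (w x - 1) := by ring
          _ ≤ (u x - b) + K * (w x - 1) := by gcongr; exact hvK x
    _ = ∫⁻ x, u x ∂Q + K * ∫⁻ x, (w x - 1) ∂Q := by
        rw [lintegral_add_left hv, lintegral_const_mul _ (hw.sub_const 1), integral_eq Q ‹_›,
          add_assoc]
    _ ≤ ∫⁻ x, u x ∂Q + K * τ := by gcongr

theorem ChiSqLE.inv_le_measure_compl_add [IsProbabilityMeasure P] (h : ChiSqLE ρ P Q)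
    (hρ : 2 ≤ ρ) {S : Set X} (hS : MeasurableSet S) : ρ⁻¹ ≤ P Sᶜ + Q S := by
  have hsq : P S ^ 2 / ρ ≤ Q S := ENNReal.div_le_of_le_mul' <| by
    have : (fun x => S.indicator (1 : X → ℝ≥0∞) x ^ 2) = S.indicator 1 :=
      funext fun x => by by_cases hx : x ∈ S <;> simp [hx]
    simpa [this, hS] using h (S.indicator 1) (measurable_one.indicator hS)
  have hsum : P S + P Sᶜ = 1 := prob_add_prob_compl hS
  calc ρ⁻¹ = (P S + P Sᶜ) ^ 2 / ρ := by simp [hsum]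
    _ = P Sᶜ * ((P S + (P S + P Sᶜ)) / ρ) + P S ^ 2 / ρ := by
        simp only [div_eq_mul_inv]
        ring
    _ ≤ P Sᶜ * 1 + Q S := by
        gcongr
        refine ENNReal.div_le_of_le_mul' ?_
        calc P S + (P S + P Sᶜ) ≤ 1 + 1 := by rw [hsum]; gcongr; exact prob_le_one
          _ ≤ ρ * 1 := by rwa [one_add_one_eq_two, mul_one]
    _ = P Sᶜ + Q S := by rw [mul_one]

end Divergences

section Tensorization

variable {X : Type*} [MeasurableSpace X] {P Q : Measure X} {ρ τ K : ℝ≥0∞}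

theorem measurable_finCons {n : ℕ} :
    Measurable fun p : X × (Fin n → X) => (Fin.cons p.1 p.2 : Fin (n + 1) → X) := by
  simpa [Fin.insertNthEquiv] using
    (MeasurableEquiv.piFinSuccAbove (fun _ : Fin (n + 1) => X) 0).symm.measurable

theorem measurable_lintegral_cons {n : ℕ} {ν : Measure (Fin n → X)} [SFinite ν]
    {φ : (Fin (n + 1) → X) → ℝ≥0∞} (hφ : Measurable φ) :
    Measurable fun x => ∫⁻ D, φ (Fin.cons x D) ∂ν :=
  (hφ.comp measurable_finCons).lintegral_prod_right'

theorem lintegral_pi_succ (μ : Measure X) [SigmaFinite μ] {n : ℕ}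
    {φ : (Fin (n + 1) → X) → ℝ≥0∞} (hφ : Measurable φ) :
    ∫⁻ D, φ D ∂(Measure.pi fun _ => μ) =
      ∫⁻ x, ∫⁻ D, φ (Fin.cons x D) ∂(Measure.pi fun _ => μ) ∂μ := by
  rw [← (measurePreserving_piFinSuccAbove (fun _ => μ) 0).symm.lintegral_comp hφ,
    lintegral_prod]
  · simp [Fin.insertNthEquiv]
  · fun_prop

theorem ChiSqLE.pi [SigmaFinite P] [SigmaFinite Q] (h : ChiSqLE ρ P Q) (n : ℕ) :
    ChiSqLE (ρ ^ n) (Measure.pi fun _ : Fin n => P) (Measure.pi fun _ : Fin n => Q) := by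
  induction n with
  | zero =>
    intro u _
    simp [Measure.pi_of_empty (fun _ : Fin 0 => P), Measure.pi_of_empty (fun _ : Fin 0 => Q)]
  | succ n ih =>
    intro u hu
    have hu_cons : ∀ x, Measurable fun D : Fin n → X => u (Fin.cons x D) := fun x =>
      hu.comp (measurable_finCons.comp measurable_prodMk_left)
    rw [lintegral_pi_succ P hu, lintegral_pi_succ Q (hu.pow_const 2)]
    set P' := Measure.pi fun _ : Fin n => P
    set Q' := Measure.pi fun _ : Fin n => Q
    calc (∫⁻ x, ∫⁻ D, u (Fin.cons x D) ∂P' ∂P) ^ 2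
        ≤ ρ * ∫⁻ x, (∫⁻ D, u (Fin.cons x D) ∂P') ^ 2 ∂Q := h _ (measurable_lintegral_cons hu)
      _ ≤ ρ * ∫⁻ x, ρ ^ n * ∫⁻ D, u (Fin.cons x D) ^ 2 ∂Q' ∂Q := by
          gcongr with x
          exact ih _ (hu_cons x)
      _ = ρ ^ (n + 1) * ∫⁻ x, ∫⁻ D, u (Fin.cons x D) ^ 2 ∂Q' ∂Q := by
          rw [lintegral_const_mul _ (measurable_lintegral_cons (hu.pow_const 2)), pow_succ']
          ring

theorem TVLE.lintegral_pi_le [IsProbabilityMeasure P] [IsProbabilityMeasure Q] (h : TVLE τ P Q)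
    {n : ℕ} {φ : (Fin n → X) → ℝ≥0∞} (hφ : Measurable φ)
    (hK : ∀ D i x, φ D ≤ φ (Function.update D i x) + K) :
    ∫⁻ D, φ D ∂(Measure.pi fun _ => P) ≤ ∫⁻ D, φ D ∂(Measure.pi fun _ => Q) + n * (K * τ) := by
  induction n with
  | zero =>
    simp [Measure.pi_of_empty (fun _ : Fin 0 => P), Measure.pi_of_empty (fun _ : Fin 0 => Q)]
  | succ n ih =>
    rw [lintegral_pi_succ P hφ, lintegral_pi_succ Q hφ]
    set P' := Measure.pi fun _ : Fin n => P
    set Q' := Measure.pi fun _ : Fin n => Q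
    have resample_tail : ∀ x, ∫⁻ D, φ (Fin.cons x D) ∂P' ≤
        ∫⁻ D, φ (Fin.cons x D) ∂Q' + n * (K * τ) := fun x =>
      ih (hφ.comp (measurable_finCons.comp measurable_prodMk_left)) fun D i y => by
        simpa [Fin.cons_update] using hK (Fin.cons x D) i.succ y
    have resample_head : ∀ x y, ∫⁻ D, φ (Fin.cons x D) ∂Q' ≤ ∫⁻ D, φ (Fin.cons y D) ∂Q' + K :=
      fun x y => by
        calc ∫⁻ D, φ (Fin.cons x D) ∂Q' ≤ ∫⁻ D, (φ (Fin.cons y D) + K) ∂Q' :=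
              lintegral_mono fun D => by simpa using hK (Fin.cons x D) 0 y
          _ = ∫⁻ D, φ (Fin.cons y D) ∂Q' + K := by simp [lintegral_add_right _ measurable_const]
    calc ∫⁻ x, ∫⁻ D, φ (Fin.cons x D) ∂P' ∂P
        ≤ ∫⁻ x, (∫⁻ D, φ (Fin.cons x D) ∂Q' + n * (K * τ)) ∂P := lintegral_mono resample_tail
      _ = ∫⁻ x, ∫⁻ D, φ (Fin.cons x D) ∂Q' ∂P + n * (K * τ) := by
          simp [lintegral_add_right _ measurable_const]
      _ ≤ ∫⁻ x, ∫⁻ D, φ (Fin.cons x D) ∂Q' ∂Q + K * τ + n * (K * τ) := by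
          gcongr
          exact h _ _ (measurable_lintegral_cons hφ) resample_head
      _ = ∫⁻ x, ∫⁻ D, φ (Fin.cons x D) ∂Q' ∂Q + (n + 1 : ℕ) * (K * τ) := by
          push_cast
          ring

end Tensorization

section Gaussian

variable {v : ℝ≥0} {a b : ℝ} {ρ τ : ℝ≥0∞}

/-- The likelihood ratio of `N(a, v)` with respect to `N(b, v)`. -/
noncomputable def gaussianRatio (v : ℝ≥0) (a b x : ℝ) : ℝ≥0∞ :=
  ENNReal.ofReal (Real.exp (((x - b) ^ 2 - (x - a) ^ 2) / (2 * v)))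

theorem measurable_gaussianRatio (v : ℝ≥0) (a b : ℝ) : Measurable (gaussianRatio v a b) := by
  unfold gaussianRatio
  fun_prop

theorem gaussianReal_eq_withDensity_gaussianRatio (hv : v ≠ 0) (a b : ℝ) :
    gaussianReal a v = (gaussianReal b v).withDensity (gaussianRatio v a b) := by
  rw [gaussianReal_of_var_ne_zero a hv, gaussianReal_of_var_ne_zero b hv,
    ← withDensity_mul _ (measurable_gaussianPDF b v) (measurable_gaussianRatio v a b)]
  congr with x
  rw [Pi.mul_apply, gaussianPDF, gaussianPDF, gaussianRatio, ← ENNReal.ofReal_mul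
    (gaussianPDFReal_nonneg b v x), gaussianPDFReal, gaussianPDFReal,
    mul_assoc _ (Real.exp _), ← Real.exp_add]
  congr 3
  ring

theorem lintegral_gaussianRatio_sq (hv : v ≠ 0) (a b : ℝ) :
    ∫⁻ x, gaussianRatio v a b x ^ 2 ∂gaussianReal b v =
      ENNReal.ofReal (Real.exp ((a - b) ^ 2 / v)) := by
  have hv' : (v : ℝ) ≠ 0 := by exact_mod_cast hv
  have ratio_sq : ∀ x, gaussianRatio v a b x ^ 2 = ENNReal.ofReal
      (Real.exp ((b ^ 2 - a ^ 2) / v) * Real.exp (2 * (a - b) / v * x)) := fun x => by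
    rw [gaussianRatio, ← ENNReal.ofReal_pow (Real.exp_pos _).le, ← Real.exp_nat_mul,
      ← Real.exp_add]
    congr 2
    push_cast
    field_simp
    ring
  have mgf_eq := congrFun (mgf_id_gaussianReal (μ := b) (v := v)) (2 * (a - b) / v)
  rw [lintegral_congr ratio_sq, ← ofReal_integral_eq_lintegral_ofReal
      ((integrable_exp_mul_gaussianReal _).const_mul _) (.of_forall fun x => by positivity),
    integral_const_mul]
  simp only [mgf, id_eq] at mgf_eq
  rw [mgf_eq, ← Real.exp_add]
  congr 2
  field_simp
  ring

theorem chiSqLE_gaussianReal (hv : v ≠ 0)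
    (h : ENNReal.ofReal (Real.exp ((a - b) ^ 2 / v)) ≤ ρ) :
    ChiSqLE ρ (gaussianReal a v) (gaussianReal b v) := by
  rw [gaussianReal_eq_withDensity_gaussianRatio hv a b]
  exact chiSqLE_withDensity (measurable_gaussianRatio v a b)
    ((lintegral_gaussianRatio_sq hv a b).trans_le h)

theorem tvLE_gaussianReal (hv : v ≠ 0)
    (h : ENNReal.ofReal (Real.exp ((a - b) ^ 2 / v)) ≤ 1 + τ ^ 2) :
    TVLE τ (gaussianReal a v) (gaussianReal b v) := by
  have hw := measurable_gaussianRatio v a b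
  have density := gaussianReal_eq_withDensity_gaussianRatio hv a b
  have : IsProbabilityMeasure ((gaussianReal b v).withDensity (gaussianRatio v a b)) :=
    density ▸ inferInstance
  have mass_one : ∫⁻ x, gaussianRatio v a b x ∂gaussianReal b v = 1 := by
    rw [← setLIntegral_univ, ← withDensity_apply _ .univ, measure_univ]
  rw [density]
  exact tvLE_withDensity hw <|
    lintegral_tsub_one_le hw mass_one ((lintegral_gaussianRatio_sq hv a b).trans_le h)

theorem lintegral_gaussianReal_eq_zero_mean {u : ℝ → ℝ≥0∞} (a : ℝ) :
    ∫⁻ y, u y ∂gaussianReal a v = ∫⁻ z, u (a + z) ∂gaussianReal 0 v := by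
  have shift := gaussianReal_map_const_add (μ := 0) (v := v) a
  rw [zero_add] at shift
  rw [← shift, (measurableEmbedding_addLeft a).lintegral_map]

end Gaussian

section DatumLaw

variable {σ : ℝ≥0} {f g : ℝ → ℝ} {u : Datum → ℝ≥0∞} {τ : unitInterval → ℝ≥0∞}

theorem measurable_observe (hf : Measurable f) :
    Measurable fun p : unitInterval × ℝ => ((f p.1 + p.2, p.1) : Datum) := by
  fun_prop

theorem isProbabilityMeasure_datumLaw (hf : Measurable f) :
    IsProbabilityMeasure (datumLaw f σ) :=
  Measure.isProbabilityMeasure_map (measurable_observe hf).aemeasurable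

theorem measurable_lintegral_response (hf : Measurable f) (hu : Measurable u) :
    Measurable fun x : unitInterval => ∫⁻ y, u (y, x) ∂gaussianReal (f x) (σ ^ 2) := by
  simp_rw [fun x : unitInterval =>
    lintegral_gaussianReal_eq_zero_mean (u := fun y => u (y, x)) (v := σ ^ 2) (f x)]
  exact (hu.comp (measurable_observe hf)).lintegral_prod_right'

theorem lintegral_datumLaw (hf : Measurable f) (hu : Measurable u) :
    ∫⁻ p, u p ∂datumLaw f σ =
      ∫⁻ x : unitInterval, ∫⁻ y, u (y, x) ∂gaussianReal (f x) (σ ^ 2) := by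
  rw [datumLaw, lintegral_map hu (measurable_observe hf),
    lintegral_prod _ (by fun_prop)]
  simp only [lintegral_gaussianReal_eq_zero_mean (f _)]

theorem chiSqLE_datumLaw (hσ : σ ≠ 0) (hf : Measurable f) (hg : Measurable g) (hτ : Measurable τ)
    (h : ∀ x : unitInterval, ENNReal.ofReal (Real.exp (((f x - g x) / σ) ^ 2)) ≤ 1 + τ x ^ 2) :
    ChiSqLE (1 + ∫⁻ x, τ x ^ 2) (datumLaw f σ) (datumLaw g σ) := fun u hu => by
  rw [lintegral_datumLaw hf hu, lintegral_datumLaw hg (hu.pow_const 2)]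
  calc (∫⁻ x : unitInterval, ∫⁻ y, u (y, x) ∂gaussianReal (f x) (σ ^ 2)) ^ 2
      ≤ (∫⁻ x, (1 + τ x ^ 2)) *
          ∫⁻ x : unitInterval, ∫⁻ y, u (y, x) ^ 2 ∂gaussianReal (g x) (σ ^ 2) := by
        refine sq_lintegral_le_mul (by fun_prop)
          (measurable_lintegral_response hg (hu.pow_const 2)) fun x => ?_
        refine chiSqLE_gaussianReal (pow_ne_zero 2 hσ) ?_ _ (by fun_prop)
        simpa [div_pow] using h x
    _ = _ := by simp [lintegral_add_left measurable_const]

theorem tvLE_datumLaw (hσ : σ ≠ 0) (hf : Measurable f) (hg : Measurable g) (hτ : Measurable τ)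
    (h : ∀ x : unitInterval, ENNReal.ofReal (Real.exp (((f x - g x) / σ) ^ 2)) ≤ 1 + τ x ^ 2) :
    TVLE (∫⁻ x, τ x) (datumLaw f σ) (datumLaw g σ) := fun u K hu hK => by
  rw [lintegral_datumLaw hf hu, lintegral_datumLaw hg hu, ← lintegral_const_mul K hτ,
    ← lintegral_add_left (measurable_lintegral_response hg hu)]
  refine lintegral_mono fun x => tvLE_gaussianReal (pow_ne_zero 2 hσ) ?_ _ _ (by fun_prop)
    fun y z => hK (y, x) (z, x)
  simpa [div_pow] using h x

end DatumLaw

section Kernels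

variable {X Y : Type*} [MeasurableSpace X] [MeasurableSpace Y] {P Q : Measure X} {ρ τ : ℝ≥0∞}

theorem ChiSqLE.comp (h : ChiSqLE ρ P Q) (M : Kernel X Y) [IsMarkovKernel M] :
    ChiSqLE ρ (M ∘ₘ P) (M ∘ₘ Q) := fun u hu => by
  rw [Measure.lintegral_bind M.aemeasurable hu.aemeasurable,
    Measure.lintegral_bind M.aemeasurable (hu.pow_const 2).aemeasurable]
  calc (∫⁻ x, ∫⁻ y, u y ∂M x ∂P) ^ 2 ≤ ρ * ∫⁻ x, (∫⁻ y, u y ∂M x) ^ 2 ∂Q :=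
        h _ hu.lintegral_kernel
    _ ≤ ρ * ∫⁻ x, ∫⁻ y, u y ^ 2 ∂M x ∂Q := by
        gcongr with x
        simpa using sq_lintegral_le_mul (μ := M x) (hu.pow_const 2) (measurable_const (a := 1))
          fun y => (mul_one _).ge

theorem IsDP.measure_le_add {R : Type*} [MeasurableSpace R] {n : ℕ} {ε δ : ℝ}
    {M : Kernel (Dataset n) R} [IsMarkovKernel M] (hM : IsDP ε δ M) {D D' : Dataset n}
    (hD : Adjacent D D') {S : Set R} (hS : MeasurableSet S) :
    M D S ≤ M D' S + (ENNReal.ofReal (Real.exp ε - 1) + ENNReal.ofReal δ) := by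
  have exp_le : ENNReal.ofReal (Real.exp ε) ≤ 1 + ENNReal.ofReal (Real.exp ε - 1) := by
    simpa using ENNReal.ofReal_add_le (p := 1) (q := Real.exp ε - 1)
  calc M D S ≤ ENNReal.ofReal (Real.exp ε) * M D' S + ENNReal.ofReal δ := hM D D' hD S hS
    _ ≤ (1 + ENNReal.ofReal (Real.exp ε - 1)) * M D' S + ENNReal.ofReal δ := by gcongr
    _ = M D' S + (ENNReal.ofReal (Real.exp ε - 1) * M D' S + ENNReal.ofReal δ) := by ring
    _ ≤ M D' S + (ENNReal.ofReal (Real.exp ε - 1) * 1 + ENNReal.ofReal δ) := by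
        gcongr
        exact prob_le_one
    _ = _ := by rw [mul_one]

theorem IsDP.comp_pi_apply_le {R : Type*} [MeasurableSpace R] {n : ℕ} {ε δ : ℝ}
    {M : Kernel (Dataset n) R} [IsMarkovKernel M] (hM : IsDP ε δ M) {P Q : Measure Datum}
    [IsProbabilityMeasure P] [IsProbabilityMeasure Q] (h : TVLE τ P Q) {S : Set R}
    (hS : MeasurableSet S) :
    (M ∘ₘ Measure.pi fun _ => P) S ≤ (M ∘ₘ Measure.pi fun _ => Q) S +
      n * ((ENNReal.ofReal (Real.exp ε - 1) + ENNReal.ofReal δ) * τ) := by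
  rw [Measure.bind_apply hS M.aemeasurable, Measure.bind_apply hS M.aemeasurable]
  exact h.lintegral_pi_le (M.measurable_coe hS) fun D i x =>
    hM.measure_le_add ⟨i, fun j hj => (Function.update_of_ne hj x D).symm⟩ hS

end Kernels

section Assouad

variable {ι : Type*} [Fintype ι] {E : Type*} [NormedAddCommGroup E] [InnerProductSpace ℝ E]
  [MeasurableSpace E] [OpensMeasurableSpace E] {e : ι → E} {s : ℝ}

theorem sum_measure_le_abs_inner_le_lintegral (he : Orthonormal ℝ e) (hs : 0 ≤ s) (μ : Measure E)
    (x : E) :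
    ENNReal.ofReal (s ^ 2) * ∑ j, μ {g | s ≤ |⟪e j, g - x⟫_ℝ|} ≤ ∫⁻ g, ‖g - x‖ₑ ^ 2 ∂μ := by
  have hmeas : ∀ j, MeasurableSet {g | s ≤ |⟪e j, g - x⟫_ℝ|} := fun j =>
    (isClosed_le continuous_const (by fun_prop)).measurableSet
  calc ENNReal.ofReal (s ^ 2) * ∑ j, μ {g | s ≤ |⟪e j, g - x⟫_ℝ|}
      = ∫⁻ g, ∑ j, {g | s ≤ |⟪e j, g - x⟫_ℝ|}.indicator (fun _ => ENNReal.ofReal (s ^ 2)) g ∂μ := by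
        rw [lintegral_finsetSum _ fun j _ => measurable_const.indicator (hmeas j), Finset.mul_sum]
        simp_rw [lintegral_indicator_const (hmeas _)]
    _ ≤ ∫⁻ g, ‖g - x‖ₑ ^ 2 ∂μ := lintegral_mono fun g => ?_
  calc ∑ j, {g | s ≤ |⟪e j, g - x⟫_ℝ|}.indicator (fun _ => ENNReal.ofReal (s ^ 2)) g
      ≤ ∑ j, ENNReal.ofReal (‖⟪e j, g - x⟫_ℝ‖ ^ 2) := by
        gcongr with j
        refine indicator_apply_le' (fun hg => ?_) fun _ => zero_le
        gcongr
        exact hg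
    _ = ENNReal.ofReal (∑ j, ‖⟪e j, g - x⟫_ℝ‖ ^ 2) :=
        (ENNReal.ofReal_sum_of_nonneg fun j _ => by positivity).symm
    _ ≤ ENNReal.ofReal (‖g - x‖ ^ 2) := by
        gcongr
        exact he.sum_inner_products_le _
    _ = ‖g - x‖ₑ ^ 2 := by rw [ENNReal.ofReal_pow (norm_nonneg _), ofReal_norm]

variable [DecidableEq ι]

theorem exists_card_mul_le_two_mul_sum {q : (ι → Bool) → ι → ℝ≥0∞} {κ : ℝ≥0∞}
    (h : ∀ θ j, κ ≤ q θ j + q (Function.update θ j (!θ j)) j) :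
    ∃ θ, Fintype.card ι * κ ≤ 2 * ∑ j, q θ j := by
  have sum_flip : ∀ j, ∑ θ, q (Function.update θ j (!θ j)) j = ∑ θ, q θ j := fun j =>
    have flip_flip : Function.Involutive fun θ : ι → Bool => Function.update θ j (!θ j) :=
      fun θ => by simp
    Equiv.sum_comp (flip_flip.toPerm _) fun θ => q θ j
  obtain ⟨θ, -, hθ⟩ := ENNReal.exists_le_of_sum_le (s := (Finset.univ : Finset (ι → Bool)))
    (f := fun _ => Fintype.card ι * κ) (g := fun θ => 2 * ∑ j, q θ j) Finset.univ_nonempty <|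
    calc ∑ _θ : ι → Bool, Fintype.card ι * κ = ∑ _j : ι, ∑ _θ : ι → Bool, κ := by
          simp only [Finset.sum_const, Finset.card_univ, nsmul_eq_mul]
          ring
      _ ≤ ∑ j, ∑ θ, (q θ j + q (Function.update θ j (!θ j)) j) := by
          gcongr with j _ θ
          exact h θ j
      _ = ∑ j, 2 * ∑ θ, q θ j := by simp only [Finset.sum_add_distrib, sum_flip, two_mul]
      _ = ∑ θ, 2 * ∑ j, q θ j := by simp only [← Finset.mul_sum, Finset.sum_comm (γ := ι)]
  exact ⟨θ, hθ⟩

theorem assouad (he : Orthonormal ℝ e) (hs : 0 ≤ s) {x : (ι → Bool) → E}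
    (hx : ∀ θ j, 2 * s ≤ |⟪e j, x θ - x (Function.update θ j (!θ j))⟫_ℝ|)
    {P : (ι → Bool) → Measure E} {κ : ℝ≥0∞}
    (hP : ∀ θ j, ∀ S, MeasurableSet S → κ ≤ P θ Sᶜ + P (Function.update θ j (!θ j)) S) :
    ∃ θ, Fintype.card ι * κ * ENNReal.ofReal (s ^ 2) ≤ 2 * ∫⁻ g, ‖g - x θ‖ₑ ^ 2 ∂P θ := by
  have error_or_error : ∀ θ j, κ ≤ P θ {g | s ≤ |⟪e j, g - x θ⟫_ℝ|} +
      P (Function.update θ j (!θ j)) {g | s ≤ |⟪e j, g - x (Function.update θ j (!θ j))⟫_ℝ|} := by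
    intro θ j
    set θ' := Function.update θ j (!θ j)
    have hmeas : MeasurableSet {g | s ≤ |⟪e j, g - x θ⟫_ℝ|} :=
      (isClosed_le continuous_const (by fun_prop)).measurableSet
    refine (hP θ j _ hmeas.compl).trans ?_
    rw [compl_compl]
    gcongr
    intro g hg
    have hg' : |⟪e j, g - x θ⟫_ℝ| < s := not_le.1 hg
    have triangle : 2 * s ≤ |⟪e j, g - x θ'⟫_ℝ - ⟪e j, g - x θ⟫_ℝ| := by
      simpa [← inner_sub_right] using hx θ j
    exact (by linarith [triangle.trans (abs_sub _ _)] : s ≤ |⟪e j, g - x θ'⟫_ℝ|)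
  obtain ⟨θ, hθ⟩ := exists_card_mul_le_two_mul_sum error_or_error
  refine ⟨θ, ?_⟩
  calc Fintype.card ι * κ * ENNReal.ofReal (s ^ 2)
      ≤ 2 * (∑ j, P θ {g | s ≤ |⟪e j, g - x θ⟫_ℝ|}) * ENNReal.ofReal (s ^ 2) := by gcongr
    _ = 2 * (ENNReal.ofReal (s ^ 2) * ∑ j, P θ {g | s ≤ |⟪e j, g - x θ⟫_ℝ|}) := by ring
    _ ≤ 2 * ∫⁻ g, ‖g - x θ‖ₑ ^ 2 ∂P θ := by
        gcongr
        exact sum_measure_le_abs_inner_le_lintegral he hs (P θ) (x θ)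

end Assouad

section Bumps

/-- The sum of `m` rescaled copies of the profile `φ`, the `j`-th of which has amplitude `c j` and
lives on `(j / m, (j + 1) / m)` when `φ` is supported in `(0, 1)`. -/
def bumpSum {m : ℕ} (φ : ℝ → ℝ) (c : Fin m → ℝ) (x : ℝ) : ℝ :=
  ∑ j, c j * φ (m * x - j)

variable {m : ℕ} {φ : ℝ → ℝ} {c : Fin m → ℝ} {x : ℝ}

theorem index_eq_of_mem_Ioo {i j : Fin m} (hi : (m : ℝ) * x - i ∈ Ioo (0 : ℝ) 1)
    (hj : (m : ℝ) * x - j ∈ Ioo (0 : ℝ) 1) : i = j := by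
  have h1 : ((i : ℕ) : ℝ) < (j : ℕ) + 1 := by linarith [hi.1, hj.2]
  have h2 : ((j : ℕ) : ℝ) < (i : ℕ) + 1 := by linarith [hj.1, hi.2]
  have h1' : (i : ℕ) < j + 1 := by exact_mod_cast h1
  have h2' : (j : ℕ) < i + 1 := by exact_mod_cast h2
  exact Fin.ext (by omega)

theorem abs_bumpSum_le {B s : ℝ} (hφ : Function.support φ ⊆ Ioo 0 1) (hB : ∀ y, |φ y| ≤ B)
    (hc : ∀ j, |c j| ≤ s) (hs : 0 ≤ s) (x : ℝ) : |bumpSum φ c x| ≤ s * B := by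
  have hB0 : 0 ≤ B := (abs_nonneg _).trans (hB 0)
  by_cases h : ∃ j : Fin m, φ (m * x - j) ≠ 0
  · obtain ⟨j, hj⟩ := h
    rw [bumpSum, Finset.sum_eq_single j (fun i _ hij => ?_) (by simp), abs_mul]
    · gcongr
      exacts [hc j, hB _]
    · rw [mul_eq_zero_of_right]
      by_contra hi
      exact hij (index_eq_of_mem_Ioo (hφ hi) (hφ hj))
  · push Not at h
    simpa [bumpSum, h] using mul_nonneg hs hB0

theorem bumpSum_zero (hφ : Function.support φ ⊆ Ioo 0 1) : bumpSum φ c 0 = 0 :=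
  Finset.sum_eq_zero fun j _ => mul_eq_zero_of_right _ <| Function.notMem_support.1 fun h => by
    linarith [(hφ h).1, (Nat.cast_nonneg j : (0 : ℝ) ≤ (j : ℕ))]

theorem bumpSum_one (hφ : Function.support φ ⊆ Ioo 0 1) : bumpSum φ c 1 = 0 :=
  Finset.sum_eq_zero fun j _ => mul_eq_zero_of_right _ <| Function.notMem_support.1 fun h => by
    have hj : ((j : ℕ) : ℝ) + 1 ≤ m := by exact_mod_cast j.2
    linarith [(hφ h).2]

theorem contDiff_bumpSum {k : ℕ∞ω} (hφ : ContDiff ℝ k φ) : ContDiff ℝ k (bumpSum φ c) :=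
  ContDiff.sum fun j _ => contDiff_const.mul (hφ.comp (by fun_prop))

theorem iteratedDeriv_bumpSum {k : ℕ} (hφ : ContDiff ℝ k φ) (x : ℝ) :
    iteratedDeriv k (bumpSum φ c) x = m ^ k * bumpSum (iteratedDeriv k φ) c x := by
  have hbump : ∀ j : Fin m, ContDiff ℝ k fun y : ℝ => φ (m * y - j) := fun j =>
    hφ.comp (by fun_prop)
  have hchain : ∀ j : Fin m, iteratedDeriv k (fun y : ℝ => φ (m * y - j)) x =
      m ^ k * iteratedDeriv k φ (m * x - j) := fun j => by
    have h := congrFun (iteratedDeriv_comp_const_mul (n := k) (f := fun y => φ (y - j))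
      (hφ.comp (by fun_prop)) m) x
    rwa [iteratedDeriv_comp_sub_const] at h
  change iteratedDeriv k (fun y => ∑ j, c j * φ (m * y - j)) x = _
  rw [iteratedDeriv_fun_sum fun j _ => (contDiff_const.mul (hbump j)).contDiffAt, bumpSum,
    Finset.mul_sum]
  refine Finset.sum_congr rfl fun j _ => ?_
  rw [iteratedDeriv_const_mul _ (hbump j).contDiffAt, hchain]
  ring

theorem bumpSum_sub_bumpSum {c c' : Fin m → ℝ} {j : Fin m} (h : ∀ i, i ≠ j → c i = c' i) (x : ℝ) :
    bumpSum φ c x - bumpSum φ c' x = (c j - c' j) * φ (m * x - j) := by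
  rw [bumpSum, bumpSum, ← Finset.sum_sub_distrib, Finset.sum_eq_single j]
  · ring
  · intro i _ hi
    rw [h i hi, sub_self]
  · simp

theorem support_iteratedDeriv_subset (φ : ℝ → ℝ) (k : ℕ) :
    Function.support (iteratedDeriv k φ) ⊆ tsupport φ := fun x hx =>
  support_iteratedFDeriv_subset k fun h => hx (by rw [iteratedDeriv_eq_iteratedFDeriv, h]; rfl)

theorem bumpSum_mul_bumpSum (hφ : Function.support φ ⊆ Ioo 0 1) (c c' : Fin m → ℝ) (x : ℝ) :
    bumpSum φ c x * bumpSum φ c' x = bumpSum (φ ^ 2) (c * c') x := by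
  rw [bumpSum, bumpSum, Finset.sum_mul_sum, bumpSum]
  refine Finset.sum_congr rfl fun i _ => ?_
  rw [Finset.sum_eq_single i _ (by simp)]
  · simp only [Pi.mul_apply, Pi.pow_apply]
    ring
  · intro j _ hji
    by_cases hi : φ (m * x - i) = 0
    · rw [hi, mul_zero, zero_mul]
    · rw [Function.notMem_support.1 fun hj => hji (index_eq_of_mem_Ioo (hφ hj) (hφ hi)), mul_zero,
        mul_zero]

theorem integral_bumpSum (hφ : Function.support φ ⊆ Ioo 0 1) (hcont : Continuous φ)
    (c : Fin m → ℝ) :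
    ∫ x in (0 : ℝ)..1, bumpSum φ c x = (∑ j, c j) / m * ∫ y in (0 : ℝ)..1, φ y := by
  have integral_bump (j : Fin m) :
      ∫ x in (0 : ℝ)..1, φ (m * x - j) = (m : ℝ)⁻¹ * ∫ y in (0 : ℝ)..1, φ y := by
    have hm : (m : ℝ) ≠ 0 := by exact_mod_cast j.pos.ne'
    have hj : ((j : ℕ) : ℝ) + 1 ≤ m := by exact_mod_cast j.2
    rw [intervalIntegral.integral_comp_mul_sub _ hm, smul_eq_mul, mul_zero, zero_sub, mul_one,
      intervalIntegral.integral_eq_integral_of_support_subset (hφ.trans fun y hy =>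
        ⟨by linarith [hy.1, (Nat.cast_nonneg j : (0 : ℝ) ≤ (j : ℕ))], by linarith [hy.2]⟩),
      intervalIntegral.integral_eq_integral_of_support_subset (hφ.trans Ioo_subset_Ioc_self)]
  simp only [bumpSum]
  rw [intervalIntegral.integral_finsetSum fun j _ =>
    (Continuous.intervalIntegrable (by fun_prop) _ _)]
  simp only [intervalIntegral.integral_const_mul, integral_bump, ← Finset.sum_mul]
  ring

/-- A bump profile: a smooth function with support inside the open unit interval and with unit
norm in `L²[0, 1]`. -/
structure IsProfile (ψ : ℝ → ℝ) : Prop where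
  contDiff : ContDiff ℝ ∞ ψ
  tsupport_subset : tsupport ψ ⊆ Ioo 0 1
  integral_sq : ∫ x in (0 : ℝ)..1, (ψ ^ 2) x = 1

theorem exists_isProfile : ∃ ψ : ℝ → ℝ, IsProfile ψ := by
  obtain ⟨φ, hsupp, hcomp, hφ, -, hpos⟩ := exists_contDiff_tsupport_subset (n := ⊤)
    (Ioo_mem_nhds (a := (0 : ℝ)) (b := 1) (x := 1 / 2) (by norm_num) (by norm_num))
  have mass_pos : 0 < ∫ x, φ x ^ 2 :=
    (hφ.continuous.pow 2).integral_pos_of_hasCompactSupport_nonneg_nonzero (x := 1 / 2)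
      (hcomp.comp_left (g := fun y : ℝ => y ^ 2) (by simp)) (fun _ => sq_nonneg _)
      (by rw [hpos]; simp)
  refine ⟨fun x => (√(∫ x, φ x ^ 2))⁻¹ * φ x, contDiff_const.mul hφ,
    tsupport_mul_subset_right.trans hsupp, ?_⟩
  simp only [Pi.pow_apply, mul_pow, inv_pow, Real.sq_sqrt mass_pos.le,
    intervalIntegral.integral_const_mul]
  rw [intervalIntegral.integral_eq_integral_of_support_subset, inv_mul_cancel₀ mass_pos.ne']
  exact fun x hx => Ioo_subset_Ioc_self (hsupp (subset_tsupport _ fun h => hx (by simp [h])))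

namespace IsProfile

variable {ψ : ℝ → ℝ}

theorem continuous (hψ : IsProfile ψ) : Continuous ψ := hψ.contDiff.continuous

theorem support_subset (hψ : IsProfile ψ) : Function.support ψ ⊆ Ioo 0 1 :=
  (subset_tsupport ψ).trans hψ.tsupport_subset

theorem continuous_bumpSum (hψ : IsProfile ψ) : Continuous (bumpSum ψ c) :=
  (contDiff_bumpSum hψ.contDiff).continuous

theorem exists_abs_iteratedDeriv_le (hψ : IsProfile ψ) (k : ℕ) :
    ∃ B, ∀ x, |iteratedDeriv k ψ x| ≤ B :=
  (hψ.contDiff.continuous_iteratedDeriv k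
    (by exact_mod_cast le_top)).bounded_above_of_compact_support <|
    HasCompactSupport.of_support_subset_isCompact isCompact_Icc <|
      (support_iteratedDeriv_subset ψ k).trans (hψ.tsupport_subset.trans Ioo_subset_Icc_self)

end IsProfile

end Bumps

section Sobolev

theorem mem_periodicSobolev_of_contDiff {f : ℝ → ℝ} {α : ℕ} {C : ℝ} (hf : ContDiff ℝ ∞ f)
    (hper : ∀ j < α, iteratedDeriv j f 0 = iteratedDeriv j f 1)
    (hC : ∀ x, |iteratedDeriv α f x| ≤ C) : f ∈ periodicSobolev α C := by
  have hfk : ∀ k : ℕ, ContDiff ℝ k f := fun k => hf.of_le (by exact_mod_cast le_top)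
  have within_eq : ∀ k : ℕ, EqOn (iteratedDerivWithin k f (Icc 0 1)) (iteratedDeriv k f)
      (Icc 0 1) := fun k x hx =>
    iteratedDerivWithin_eq_iteratedDeriv (uniqueDiffOn_Icc zero_lt_one) (hfk k).contDiffAt hx
  have hcont : Continuous (iteratedDeriv α f) := (hfk α).continuous_iteratedDeriv' α
  refine ⟨(hfk _).contDiffOn, ?_, fun j hj => ?_, ?_, ?_⟩
  · have hC1 : ContDiffOn ℝ 1 (iteratedDerivWithin (α - 1) f (Icc 0 1)) (uIcc 0 1) := by
      rw [uIcc_of_le zero_le_one]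
      refine ContDiffOn.congr (ContDiff.contDiffOn ?_) (within_eq (α - 1))
      rw [iteratedDeriv_eq_iterate]
      exact_mod_cast ContDiff.iterate_deriv' 1 (α - 1) (hfk (1 + (α - 1)))
    exact hC1.absolutelyContinuousOnInterval
  · rw [within_eq j (left_mem_Icc.2 zero_le_one), within_eq j (right_mem_Icc.2 zero_le_one),
      hper j hj]
  · refine MemLp.of_bound (C := C) (hcont.aestronglyMeasurable.congr ?_) ?_
    · filter_upwards [ae_restrict_mem measurableSet_Icc] with x hx using (within_eq α hx).symm
    · filter_upwards [ae_restrict_mem measurableSet_Icc] with x hx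
      rw [within_eq α hx]
      exact hC x
  · calc ∫ x in (0 : ℝ)..1, (iteratedDerivWithin α f (Icc 0 1) x) ^ 2
        = ∫ x in (0 : ℝ)..1, (iteratedDeriv α f x) ^ 2 := by
          refine intervalIntegral.integral_congr fun x hx => ?_
          rw [uIcc_of_le zero_le_one] at hx
          simp only [within_eq α hx]
      _ ≤ ∫ _ in (0 : ℝ)..1, C ^ 2 :=
          intervalIntegral.integral_mono_on zero_le_one ((hcont.pow 2).intervalIntegrable _ _)
            intervalIntegrable_const fun x _ => sq_le_sq' (abs_le.1 (hC x)).1 (abs_le.1 (hC x)).2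
      _ = C ^ 2 := by simp

theorem bumpSum_mem_periodicSobolev {m α : ℕ} {ψ : ℝ → ℝ} {c : Fin m → ℝ} {s B C : ℝ}
    (hψ : IsProfile ψ) (hB : ∀ x, |iteratedDeriv α ψ x| ≤ B) (hs : 0 ≤ s)
    (hc : ∀ j, |c j| ≤ s) (hC : m ^ α * (s * B) ≤ C) : bumpSum ψ c ∈ periodicSobolev α C := by
  have hψk : ∀ k : ℕ, ContDiff ℝ k ψ := fun k => hψ.contDiff.of_le (by exact_mod_cast le_top)
  have hsupp' : ∀ k : ℕ, Function.support (iteratedDeriv k ψ) ⊆ Ioo 0 1 := fun k =>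
    (support_iteratedDeriv_subset ψ k).trans hψ.tsupport_subset
  refine mem_periodicSobolev_of_contDiff (contDiff_bumpSum hψ.contDiff) (fun j _ => ?_) fun x => ?_
  · rw [iteratedDeriv_bumpSum (hψk j), iteratedDeriv_bumpSum (hψk j), bumpSum_zero (hsupp' j),
      bumpSum_one (hsupp' j)]
  · calc |iteratedDeriv α (bumpSum ψ c) x| = m ^ α * |bumpSum (iteratedDeriv α ψ) c x| := by
          rw [iteratedDeriv_bumpSum (hψk α), abs_mul, abs_of_nonneg (by positivity)]
      _ ≤ m ^ α * (s * B) := by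
          gcongr
          exact abs_bumpSum_le (hsupp' α) hB hc hs x
      _ ≤ C := hC

end Sobolev

section UnitL2

/-- The class in `L²[0, 1]` of the restriction to `[0, 1]` of a continuous function. -/
noncomputable def toL2 (f : ℝ → ℝ) (hf : Continuous f) : L2Unit :=
  ContinuousMap.toLp 2 volume ℝ ⟨fun x : unitInterval => f x, by fun_prop⟩

variable {f g : ℝ → ℝ}

theorem coeFn_toL2 (hf : Continuous f) : toL2 f hf =ᵐ[volume] fun x : unitInterval => f x :=
  ContinuousMap.coeFn_toLp (p := 2) (𝕜 := ℝ) volume _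

theorem inner_toL2 (hf : Continuous f) (hg : Continuous g) :
    ⟪toL2 f hf, toL2 g hg⟫_ℝ = ∫ x in (0 : ℝ)..1, f x * g x := by
  rw [toL2, toL2, ContinuousMap.inner_toLp, intervalIntegral.integral_of_le zero_le_one,
    ← integral_Icc_eq_integral_Ioc, ← integral_subtype measurableSet_Icc]
  simp [mul_comm]

theorem enorm_sub_toL2_sq (g : L2Unit) (hf : Continuous f) :
    ‖g - toL2 f hf‖ₑ ^ 2 = ∫⁻ x : unitInterval, ENNReal.ofReal ((g x - f x) ^ 2) := by
  have h := eLpNorm_nnreal_pow_eq_lintegral (μ := (volume : Measure unitInterval))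
    (f := (g - toL2 f hf : L2Unit)) (p := 2) two_ne_zero
  simp only [NNReal.coe_ofNat, ENNReal.coe_ofNat, ENNReal.rpow_ofNat] at h
  rw [Lp.enorm_def]
  refine h.trans (lintegral_congr_ae ?_)
  filter_upwards [Lp.coeFn_sub g (toL2 f hf), coeFn_toL2 hf] with x hsub hx
  rw [hsub, Pi.sub_apply, hx, ← ofReal_norm, ← ENNReal.ofReal_pow (norm_nonneg _),
    Real.norm_eq_abs, sq_abs]

theorem mise_eq_lintegral {n : ℕ} {σ : ℝ≥0} (M : Kernel (Dataset n) L2Unit) (hf : Continuous f) :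
    mise σ M f = ∫⁻ g, ‖g - toL2 f hf‖ₑ ^ 2 ∂(M ∘ₘ dataLaw n f σ) := by
  rw [Measure.lintegral_bind M.aemeasurable (by fun_prop)]
  simp only [mise, enorm_sub_toL2_sq]

end UnitL2

section Hypercube

variable {m : ℕ} {ψ : ℝ → ℝ}

theorem inner_toL2_bumpSum (hψ : IsProfile ψ) (c c' : Fin m → ℝ) :
    ⟪toL2 (bumpSum ψ c) hψ.continuous_bumpSum, toL2 (bumpSum ψ c') hψ.continuous_bumpSum⟫_ℝ =
      (∑ j, c j * c' j) / m := by
  simp only [inner_toL2, bumpSum_mul_bumpSum hψ.support_subset]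
  rw [integral_bumpSum (fun x hx => hψ.support_subset fun h => hx (by simp [h]))
    (hψ.continuous.pow 2), hψ.integral_sq, mul_one]
  rfl

/-- The `j`-th bump, normalized in `L²[0, 1]`. -/
noncomputable def unitBump (hψ : IsProfile ψ) (j : Fin m) : L2Unit :=
  toL2 (bumpSum ψ (Pi.single j √m)) hψ.continuous_bumpSum

theorem inner_unitBump (hψ : IsProfile ψ) (j : Fin m) (c : Fin m → ℝ) :
    ⟪unitBump hψ j, toL2 (bumpSum ψ c) hψ.continuous_bumpSum⟫_ℝ = c j / √m := by
  have hm : (0 : ℝ) < m := by exact_mod_cast j.pos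
  rw [unitBump, inner_toL2_bumpSum hψ, Finset.sum_eq_single j
    (fun i _ hi => by rw [Pi.single_eq_of_ne hi, zero_mul]) (by simp), Pi.single_eq_same]
  field_simp
  rw [Real.sq_sqrt hm.le, mul_comm]

theorem orthonormal_unitBump (hψ : IsProfile ψ) : Orthonormal ℝ (unitBump hψ (m := m)) := by
  refine orthonormal_iff_ite.2 fun i j => ?_
  have hm : (0 : ℝ) < m := by exact_mod_cast i.pos
  rw [unitBump.eq_def hψ j, inner_unitBump]
  split_ifs with h
  · rw [h, Pi.single_eq_same, div_self (by positivity)]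
  · rw [Pi.single_eq_of_ne h, zero_div]

/-- The coefficients of the vertex `θ` of the hypercube of bump sums of amplitude `a`. -/
def vertex (a : ℝ) (θ : Fin m → Bool) (j : Fin m) : ℝ := if θ j then a else 0

variable {a : ℝ}

theorem abs_vertex_le (ha : 0 ≤ a) (θ : Fin m → Bool) (j : Fin m) : |vertex a θ j| ≤ a := by
  rw [vertex]
  split_ifs
  exacts [(abs_of_nonneg ha).le, abs_zero.trans_le ha]

theorem abs_vertex_sub_vertex_flip (ha : 0 ≤ a) (θ : Fin m → Bool) (j : Fin m) :
    |vertex a θ j - vertex a (Function.update θ j (!θ j)) j| = a := by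
  cases h : θ j <;> simp [vertex, h, abs_of_nonneg ha]

theorem vertex_flip_of_ne (θ : Fin m → Bool) {i j : Fin m} (h : i ≠ j) :
    vertex a θ i = vertex a (Function.update θ j (!θ j)) i := by
  simp [vertex, h]

theorem le_iSup_mise {n α : ℕ} {σ : ℝ≥0} {B C L : ℝ} (hψ : IsProfile ψ)
    (hB : ∀ x, |iteratedDeriv α ψ x| ≤ B) (hm : 0 < m) (hL : 0 ≤ L) (hLC : L * B ≤ C)
    (M : Kernel (Dataset n) L2Unit)
    (h : ∀ (θ : Fin m → Bool) (j : Fin m) (S : Set L2Unit), MeasurableSet S →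
      4⁻¹ ≤ (M ∘ₘ dataLaw n (bumpSum ψ (vertex (L / m ^ α) θ)) σ) Sᶜ +
        (M ∘ₘ dataLaw n (bumpSum ψ (vertex (L / m ^ α) (Function.update θ j (!θ j)))) σ) S) :
    ENNReal.ofReal (L ^ 2 / 32 * ((m : ℝ) ^ (2 * α))⁻¹) ≤
      ⨆ f ∈ periodicSobolev α C, mise σ M f := by
  have hm' : (0 : ℝ) < m := by exact_mod_cast hm
  set a := L / (m : ℝ) ^ α with ha_def
  have ha : 0 ≤ a := by positivity
  obtain ⟨θ, hθ⟩ := assouad (orthonormal_unitBump hψ) (s := a / (2 * √m)) (by positivity)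
    (x := fun θ => toL2 (bumpSum ψ (vertex a θ)) hψ.continuous_bumpSum)
    (fun θ j => by
      rw [inner_sub_right, inner_unitBump, inner_unitBump, ← sub_div, abs_div,
        abs_vertex_sub_vertex_flip ha, abs_of_nonneg (Real.sqrt_nonneg _)]
      exact le_of_eq (by ring)) h
  rw [← mise_eq_lintegral M, Fintype.card_fin] at hθ
  refine le_iSup₂_of_le (bumpSum ψ (vertex a θ)) (bumpSum_mem_periodicSobolev hψ hB ha
    (abs_vertex_le ha θ) (le_of_eq_of_le ?_ hLC)) ?_
  · rw [ha_def]
    field_simp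
  · refine (ENNReal.mul_le_mul_iff_right two_ne_zero ENNReal.ofNat_ne_top).1 (le_of_eq_of_le ?_ hθ)
    have four_inv : (4 : ℝ≥0∞)⁻¹ = ENNReal.ofReal 4⁻¹ := by
      rw [ENNReal.ofReal_inv_of_pos (by norm_num), ENNReal.ofReal_ofNat]
    rw [four_inv, ← ENNReal.ofReal_natCast, ← ENNReal.ofReal_ofNat 2,
      ← ENNReal.ofReal_mul (by positivity), ← ENNReal.ofReal_mul (by positivity),
      ← ENNReal.ofReal_mul (by positivity), ha_def]
    congr 1
    rw [div_pow, div_pow, mul_pow, Real.sq_sqrt hm'.le]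
    field_simp
    ring

end Hypercube

section LocalPerturbation

variable {f g : ℝ → ℝ} {σ : ℝ≥0} {r : ℝ} {A : Set unitInterval}

theorem ofReal_exp_sq_le_one_add_indicator (hσ : σ ≠ 0) (hr : r ≤ 1)
    (hoff : ∀ x ∉ A, f x = g x) (hle : ∀ x ∈ A, |f x - g x| ≤ r * σ) (x : unitInterval) :
    ENNReal.ofReal (Real.exp (((f x - g x) / σ) ^ 2)) ≤
      1 + A.indicator (fun _ => ENNReal.ofReal (2 * r)) x ^ 2 := by
  by_cases hx : x ∈ A
  · have hσ' : (0 : ℝ) < σ := by exact_mod_cast pos_iff_ne_zero.2 hσ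
    set t := (f x - g x) / σ
    have ht : |t| ≤ r := by
      rw [abs_div, abs_of_pos hσ', div_le_iff₀ hσ']
      exact hle x hx
    have hr0 : 0 ≤ r := (abs_nonneg t).trans ht
    have ht2 : t ^ 2 ≤ r ^ 2 := sq_le_sq' (abs_le.1 ht).1 (abs_le.1 ht).2
    have hexp : Real.exp (t ^ 2) ≤ 1 + (2 * r) ^ 2 := by
      have h := Real.abs_exp_sub_one_le (x := t ^ 2) (by rw [abs_sq]; nlinarith)
      rw [abs_sq] at h
      nlinarith [le_abs_self (Real.exp (t ^ 2) - 1)]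
    calc ENNReal.ofReal (Real.exp (t ^ 2)) ≤ ENNReal.ofReal (1 + (2 * r) ^ 2) := by gcongr
      _ = 1 + A.indicator (fun _ => ENNReal.ofReal (2 * r)) x ^ 2 := by
        rw [ENNReal.ofReal_add one_pos.le (by positivity), ENNReal.ofReal_one,
          ENNReal.ofReal_pow (by positivity), indicator_of_mem hx]
  · simp [hoff x hx, hx]

theorem chiSqLE_datumLaw_of_eq_off (hσ : σ ≠ 0) (hf : Measurable f) (hg : Measurable g)
    (hA : MeasurableSet A) (hr : r ≤ 1) (hoff : ∀ x ∉ A, f x = g x)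
    (hle : ∀ x ∈ A, |f x - g x| ≤ r * σ) :
    ChiSqLE (1 + ENNReal.ofReal (2 * r) ^ 2 * volume A) (datumLaw f σ) (datumLaw g σ) := by
  have h := chiSqLE_datumLaw hσ hf hg (measurable_const.indicator hA)
    (ofReal_exp_sq_le_one_add_indicator hσ hr hoff hle)
  have sq_indicator : (fun x => A.indicator (fun _ => ENNReal.ofReal (2 * r)) x ^ 2) =
      A.indicator fun _ => ENNReal.ofReal (2 * r) ^ 2 :=
    funext fun x => by by_cases hx : x ∈ A <;> simp [hx]
  rwa [sq_indicator, lintegral_indicator_const hA] at h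

theorem tvLE_datumLaw_of_eq_off (hσ : σ ≠ 0) (hf : Measurable f) (hg : Measurable g)
    (hA : MeasurableSet A) (hr : r ≤ 1) (hoff : ∀ x ∉ A, f x = g x)
    (hle : ∀ x ∈ A, |f x - g x| ≤ r * σ) :
    TVLE (ENNReal.ofReal (2 * r) * volume A) (datumLaw f σ) (datumLaw g σ) := by
  have h := tvLE_datumLaw hσ hf hg (measurable_const.indicator hA)
    (ofReal_exp_sq_le_one_add_indicator hσ hr hoff hle)
  rwa [lintegral_indicator_const hA] at h

/-- The part of `[0, 1]` on which the `j`-th of `m` bumps lives. -/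
def cell {m : ℕ} (j : Fin m) : Set unitInterval := {x | (m : ℝ) * x - j ∈ Ioo (0 : ℝ) 1}

theorem measurableSet_cell {m : ℕ} (j : Fin m) : MeasurableSet (cell j) :=
  measurableSet_Ioo.preimage (by fun_prop)

theorem volume_cell_le {m : ℕ} (j : Fin m) : volume (cell j) ≤ ENNReal.ofReal (m : ℝ)⁻¹ := by
  have hm : (0 : ℝ) < m := by exact_mod_cast j.pos
  calc volume (cell j) = volume (Subtype.val '' cell j) := unitInterval.volume_apply
    _ ≤ volume (Ioo ((j : ℝ) / m) ((j + 1) / m)) := by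
        refine measure_mono ?_
        rintro _ ⟨x, hx, rfl⟩
        rw [mem_Ioo, div_lt_iff₀ hm, lt_div_iff₀ hm]
        exact ⟨by linarith [hx.1], by linarith [hx.2]⟩
    _ = ENNReal.ofReal (m : ℝ)⁻¹ := by
        rw [Real.volume_Ioo]
        congr 1
        ring

end LocalPerturbation

section Vertices

variable {m α : ℕ} {ψ : ℝ → ℝ} {a b B L : ℝ} {σ : ℝ≥0}

theorem bumpSum_vertex_eq_off_cell (hψ : IsProfile ψ) (θ : Fin m → Bool) (j : Fin m) :
    ∀ x ∉ cell j, bumpSum ψ (vertex a θ) x =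
      bumpSum ψ (vertex a (Function.update θ j (!θ j))) x := fun x hx => by
  rw [← sub_eq_zero, bumpSum_sub_bumpSum fun i hi => vertex_flip_of_ne θ hi,
    Function.notMem_support.1 fun h => hx (hψ.support_subset h), mul_zero]

theorem abs_bumpSum_vertex_sub_le (hB : ∀ x, |ψ x| ≤ B) (ha : 0 ≤ a) (θ : Fin m → Bool)
    (j : Fin m) (x : ℝ) :
    |bumpSum ψ (vertex a θ) x - bumpSum ψ (vertex a (Function.update θ j (!θ j))) x| ≤ a * B := by
  rw [bumpSum_sub_bumpSum fun i hi => vertex_flip_of_ne θ hi, abs_mul,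
    abs_vertex_sub_vertex_flip ha]
  gcongr
  exact hB _

theorem abs_bumpSum_vertex_sub_le_mul (hB : ∀ x, |ψ x| ≤ B) (hL : 0 ≤ L) (hLB : L * B ≤ b * σ)
    (θ : Fin m → Bool) (j : Fin m) (x : ℝ) :
    |bumpSum ψ (vertex (L / m ^ α) θ) x -
      bumpSum ψ (vertex (L / m ^ α) (Function.update θ j (!θ j))) x| ≤ b / m ^ α * σ :=
  calc _ ≤ L / m ^ α * B := abs_bumpSum_vertex_sub_le hB (by positivity) θ j x
    _ = L * B / m ^ α := by ring
    _ ≤ b * σ / m ^ α := by gcongr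
    _ = b / m ^ α * σ := by ring

theorem div_natCast_pow_le_one (hb : b ≤ 1) (j : Fin m) (k : ℕ) : b / (m : ℝ) ^ k ≤ 1 := by
  have hm : (1 : ℝ) ≤ m := by exact_mod_cast j.pos
  exact div_le_one_of_le₀ (hb.trans (one_le_pow₀ hm)) (by positivity)

theorem chiSqLE_datumLaw_vertex (hψ : IsProfile ψ) (hσ : σ ≠ 0) (hB : ∀ x, |ψ x| ≤ B) (hL : 0 ≤ L)
    (hb0 : 0 ≤ b) (hb1 : b ≤ 1) (hLB : L * B ≤ b * σ) (θ : Fin m → Bool) (j : Fin m) :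
    ChiSqLE (1 + ENNReal.ofReal ((2 * b) ^ 2 / m ^ (2 * α + 1)))
      (datumLaw (bumpSum ψ (vertex (L / m ^ α) θ)) σ)
      (datumLaw (bumpSum ψ (vertex (L / m ^ α) (Function.update θ j (!θ j)))) σ) := by
  refine (chiSqLE_datumLaw_of_eq_off hσ hψ.continuous_bumpSum.measurable
    hψ.continuous_bumpSum.measurable (measurableSet_cell j) (div_natCast_pow_le_one hb1 j α)
    (bumpSum_vertex_eq_off_cell hψ θ j)
    fun x _ => abs_bumpSum_vertex_sub_le_mul hB hL hLB θ j x).mono ?_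
  gcongr
  calc ENNReal.ofReal (2 * (b / m ^ α)) ^ 2 * volume (cell j)
      ≤ ENNReal.ofReal (2 * (b / m ^ α)) ^ 2 * ENNReal.ofReal (m : ℝ)⁻¹ := by
        gcongr
        exact volume_cell_le j
    _ = ENNReal.ofReal ((2 * b) ^ 2 / m ^ (2 * α + 1)) := by
        rw [← ENNReal.ofReal_pow (by positivity), ← ENNReal.ofReal_mul (by positivity)]
        congr 1
        ring

theorem tvLE_datumLaw_vertex (hψ : IsProfile ψ) (hσ : σ ≠ 0) (hB : ∀ x, |ψ x| ≤ B) (hL : 0 ≤ L)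
    (hb0 : 0 ≤ b) (hb1 : b ≤ 1) (hLB : L * B ≤ b * σ) (θ : Fin m → Bool) (j : Fin m) :
    TVLE (ENNReal.ofReal (2 * b / m ^ (α + 1)))
      (datumLaw (bumpSum ψ (vertex (L / m ^ α) θ)) σ)
      (datumLaw (bumpSum ψ (vertex (L / m ^ α) (Function.update θ j (!θ j)))) σ) := by
  refine (tvLE_datumLaw_of_eq_off hσ hψ.continuous_bumpSum.measurable
    hψ.continuous_bumpSum.measurable (measurableSet_cell j) (div_natCast_pow_le_one hb1 j α)
    (bumpSum_vertex_eq_off_cell hψ θ j)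
    fun x _ => abs_bumpSum_vertex_sub_le_mul hB hL hLB θ j x).mono ?_
  calc ENNReal.ofReal (2 * (b / m ^ α)) * volume (cell j)
      ≤ ENNReal.ofReal (2 * (b / m ^ α)) * ENNReal.ofReal (m : ℝ)⁻¹ := by
        gcongr
        exact volume_cell_le j
    _ = ENNReal.ofReal (2 * b / m ^ (α + 1)) := by
        rw [← ENNReal.ofReal_mul (by positivity)]
        congr 1
        ring

end Vertices

section Testing

theorem one_add_ofReal_pow_le_four {t : ℝ} {n : ℕ} (ht : 0 ≤ t) (h : n * t ≤ 1) :
    (1 + ENNReal.ofReal t) ^ n ≤ 4 := by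
  have real_bound : (1 + t) ^ n ≤ 4 :=
    calc (1 + t) ^ n ≤ Real.exp t ^ n := by
          gcongr
          linarith [Real.add_one_le_exp t]
      _ = Real.exp (n * t) := (Real.exp_nat_mul t n).symm
      _ ≤ Real.exp 1 := by gcongr
      _ ≤ 4 := by linarith [Real.exp_one_lt_three]
  rw [← ENNReal.ofReal_one, ← ENNReal.ofReal_add one_pos.le ht,
    ← ENNReal.ofReal_pow (by positivity)]
  simpa using ENNReal.ofReal_le_ofReal real_bound

variable {R : Type*} [MeasurableSpace R] {n : ℕ} {P Q : Measure Datum} [IsProbabilityMeasure P]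
  [IsProbabilityMeasure Q] {M : Kernel (Dataset n) R} [IsMarkovKernel M] {S : Set R}

theorem inv_four_le_of_chiSqLE {t : ℝ} (h : ChiSqLE (1 + ENNReal.ofReal t) P Q) (ht : 0 ≤ t)
    (hn : n * t ≤ 1) (hS : MeasurableSet S) :
    4⁻¹ ≤ (M ∘ₘ Measure.pi fun _ => P) Sᶜ + (M ∘ₘ Measure.pi fun _ => Q) S :=
  (((h.pi n).mono (one_add_ofReal_pow_le_four ht hn)).comp M).inv_le_measure_compl_add
    (by norm_num) hS

theorem exp_sub_one_le_two_mul {ε : ℝ} (h0 : 0 ≤ ε) (h1 : ε ≤ 1) : Real.exp ε - 1 ≤ 2 * ε := by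
  have h := Real.abs_exp_sub_one_le (x := ε) (by rwa [abs_of_nonneg h0])
  rw [abs_of_nonneg h0] at h
  exact (le_abs_self _).trans h

theorem IsDP.inv_four_le_of_tvLE {ε δ K t : ℝ} (hM : IsDP ε δ M)
    (h : TVLE (ENNReal.ofReal t) P Q) (hε0 : 0 ≤ ε) (hε1 : ε ≤ 1) (hK : 0 ≤ K) (hδ : δ ≤ K * ε)
    (hn : (2 + K) * (n * ε) * t ≤ 1 / 2) (hS : MeasurableSet S) :
    4⁻¹ ≤ (M ∘ₘ Measure.pi fun _ => P) Sᶜ + (M ∘ₘ Measure.pi fun _ => Q) S := by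
  have privacy_loss : n * ((ENNReal.ofReal (Real.exp ε - 1) + ENNReal.ofReal δ) *
      ENNReal.ofReal t) ≤ 2⁻¹ :=
    calc n * ((ENNReal.ofReal (Real.exp ε - 1) + ENNReal.ofReal δ) * ENNReal.ofReal t)
        ≤ n * ((ENNReal.ofReal (2 * ε) + ENNReal.ofReal (K * ε)) * ENNReal.ofReal t) := by
          gcongr
          exact exp_sub_one_le_two_mul hε0 hε1
      _ = ENNReal.ofReal ((2 + K) * (n * ε) * t) := by
          rw [← ENNReal.ofReal_add (by positivity) (by positivity), ← ENNReal.ofReal_natCast,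
            ← ENNReal.ofReal_mul (by positivity), ← ENNReal.ofReal_mul (by positivity)]
          congr 1
          ring
      _ ≤ ENNReal.ofReal (1 / 2) := by gcongr
      _ = 2⁻¹ := by rw [one_div, ENNReal.ofReal_inv_of_pos two_pos, ENNReal.ofReal_ofNat]
  have half_le : 2⁻¹ ≤ (M ∘ₘ Measure.pi fun _ => P) Sᶜ + (M ∘ₘ Measure.pi fun _ => Q) S := by
    refine (ENNReal.add_le_add_iff_right (a := 2⁻¹) (by simp)).1 ?_
    calc (2⁻¹ : ℝ≥0∞) + 2⁻¹ = 1 := ENNReal.inv_two_add_inv_two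
      _ = (M ∘ₘ Measure.pi fun _ => P) Sᶜ + (M ∘ₘ Measure.pi fun _ => P) S := by
          rw [add_comm, prob_add_prob_compl hS]
      _ ≤ (M ∘ₘ Measure.pi fun _ => P) Sᶜ + ((M ∘ₘ Measure.pi fun _ => Q) S + 2⁻¹) := by
          gcongr
          exact (hM.comp_pi_apply_le h hS).trans (by gcongr)
      _ = _ := (add_assoc _ _ _).symm
  exact le_trans (ENNReal.inv_le_inv.2 (by norm_num)) half_le

end Testing

section Rates

theorem exists_width (p k : ℕ) (hp : 0 < p) {y₀ : ℝ} (hy₀ : 0 < y₀) :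
    ∃ κ : ℝ, 0 < κ ∧ ∀ y : ℝ, y₀ ≤ y → ∃ m : ℕ, 0 < m ∧ y ≤ (m : ℝ) ^ p ∧
      κ * y ^ (-(k : ℝ) / p) ≤ ((m : ℝ) ^ k)⁻¹ := by
  have hp' : (p : ℝ) ≠ 0 := by exact_mod_cast hp.ne'
  have root_pow : ∀ {y : ℝ}, 0 < y → ∀ i : ℕ, (y ^ (1 / (p : ℝ))) ^ i = y ^ ((i : ℝ) / p) :=
    fun hy i => by
      rw [← Real.rpow_mul_natCast hy.le]
      congr 1
      ring
  set x₀ := y₀ ^ (1 / (p : ℝ))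
  have hx₀ : 0 < x₀ := Real.rpow_pos_of_pos hy₀ _
  refine ⟨((1 + 1 / x₀) ^ k)⁻¹, by positivity, fun y hy => ?_⟩
  have hy0 : 0 < y := hy₀.trans_le hy
  set x := y ^ (1 / (p : ℝ)) with hx_def
  have hx : 0 < x := Real.rpow_pos_of_pos hy0 _
  have one_le : 1 ≤ x / x₀ :=
    (one_le_div hx₀).2 (Real.rpow_le_rpow hy₀.le hy (by positivity))
  refine ⟨⌈x⌉₊, Nat.ceil_pos.2 hx, ?_, ?_⟩
  · calc y = x ^ p := by rw [hx_def, root_pow hy0, div_self hp', Real.rpow_one]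
      _ ≤ (⌈x⌉₊ : ℝ) ^ p := by
          gcongr
          exact Nat.le_ceil x
  · have ceil_le : (⌈x⌉₊ : ℝ) ≤ (1 + 1 / x₀) * x := by
      calc (⌈x⌉₊ : ℝ) ≤ x + 1 := (Nat.ceil_lt_add_one hx.le).le
        _ ≤ x + x / x₀ := by gcongr
        _ = (1 + 1 / x₀) * x := by ring
    have : (0 : ℝ) < ⌈x⌉₊ := by exact_mod_cast Nat.ceil_pos.2 hx
    calc ((1 + 1 / x₀) ^ k)⁻¹ * y ^ (-(k : ℝ) / p) = (((1 + 1 / x₀) * x) ^ k)⁻¹ := by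
          rw [neg_div, Real.rpow_neg hy0.le, ← root_pow hy0, ← mul_inv, ← mul_pow]
      _ ≤ ((⌈x⌉₊ : ℝ) ^ k)⁻¹ := by gcongr

theorem exists_amplitude (α : ℕ) {ψ : ℝ → ℝ} (hψ : IsProfile ψ) {C s : ℝ} (hC : 0 < C)
    (hs : 0 < s) :
    ∃ L B : ℝ, 0 < L ∧ (∀ x, |ψ x| ≤ B) ∧ (∀ x, |iteratedDeriv α ψ x| ≤ B) ∧ L * B ≤ C ∧
      L * B ≤ s := by
  obtain ⟨B₀, hB₀⟩ := hψ.exists_abs_iteratedDeriv_le 0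
  obtain ⟨B₁, hB₁⟩ := hψ.exists_abs_iteratedDeriv_le α
  set B := max 1 (max B₀ B₁)
  have hB : 0 < B := one_pos.trans_le (le_max_left _ _)
  have amplitude_mul : min C s / B * B = min C s := div_mul_cancel₀ _ hB.ne'
  exact ⟨min C s / B, B, by positivity,
    fun x => (hB₀ x).trans ((le_max_left _ _).trans (le_max_right _ _)),
    fun x => (hB₁ x).trans ((le_max_right _ _).trans (le_max_right _ _)),
    amplitude_mul.trans_le (min_le_left _ _), amplitude_mul.trans_le (min_le_right _ _)⟩

variable (α : ℕ) {C : ℝ} {σ : ℝ≥0}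

theorem exists_sample_lower_bound (hC : 0 < C) (hσ : 0 < σ) :
    ∃ c : ℝ, 0 < c ∧ ∀ (n : ℕ) (M : Kernel (Dataset n) L2Unit) [IsMarkovKernel M], 0 < n →
      ENNReal.ofReal (c * (n : ℝ) ^ (-(2 * (α : ℝ)) / (2 * (α : ℝ) + 1))) ≤
        ⨆ f ∈ periodicSobolev α C, mise σ M f := by
  obtain ⟨ψ, hψ⟩ := exists_isProfile
  obtain ⟨L, B, hL, hB, hBα, hLC, hLσ⟩ := exists_amplitude α hψ hC (s := 1 / 2 * σ) (by positivity)
  obtain ⟨κ, hκ, hwidth⟩ := exists_width (2 * α + 1) (2 * α) (by positivity) one_pos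
  refine ⟨L ^ 2 / 32 * κ, by positivity, fun n M _ hn => ?_⟩
  obtain ⟨m, hm, hnm, hrate⟩ := hwidth n (by exact_mod_cast hn)
  have : (0 : ℝ) < m := by exact_mod_cast hm
  push_cast at hrate
  have hprob (θ : Fin m → Bool) :
      IsProbabilityMeasure (datumLaw (bumpSum ψ (vertex (L / (m : ℝ) ^ α) θ)) σ) :=
    isProbabilityMeasure_datumLaw hψ.continuous_bumpSum.measurable
  refine le_trans (ENNReal.ofReal_le_ofReal ?_) <|
    le_iSup_mise hψ hBα hm hL.le hLC M fun θ j S hS =>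
      inv_four_le_of_chiSqLE (chiSqLE_datumLaw_vertex hψ hσ.ne' hB hL.le (by norm_num)
        (by norm_num) hLσ θ j) (by positivity) ?_ hS
  · rw [mul_assoc]
    gcongr
  · calc (n : ℝ) * ((2 * (1 / 2)) ^ 2 / m ^ (2 * α + 1)) = n / m ^ (2 * α + 1) := by ring
      _ ≤ 1 := div_le_one_of_le₀ hnm (by positivity)

theorem exists_private_lower_bound (hC : 0 < C) (hσ : 0 < σ) {a K : ℝ} (ha : 0 < a) (hK : 0 ≤ K) :
    ∃ c : ℝ, 0 < c ∧ ∀ (n : ℕ) (ε δ : ℝ) (M : Kernel (Dataset n) L2Unit) [IsMarkovKernel M],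
      IsDP ε δ M → 0 ≤ ε → ε ≤ 1 → δ ≤ K * ε → a ≤ n * ε →
      ENNReal.ofReal (c * ((n : ℝ) * ε) ^ (-(2 * (α : ℝ)) / ((α : ℝ) + 1))) ≤
        ⨆ f ∈ periodicSobolev α C, mise σ M f := by
  obtain ⟨ψ, hψ⟩ := exists_isProfile
  set b := 1 / (4 * (2 + K))
  have hb1 : b ≤ 1 := div_le_one_of_le₀ (by linarith) (by positivity)
  obtain ⟨L, B, hL, hB, hBα, hLC, hLσ⟩ := exists_amplitude α hψ hC (s := b * σ) (by positivity)
  obtain ⟨κ, hκ, hwidth⟩ := exists_width (α + 1) (2 * α) (by positivity) ha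
  refine ⟨L ^ 2 / 32 * κ, by positivity, fun n ε δ M _ hM hε0 hε1 hδ han => ?_⟩
  obtain ⟨m, hm, hnm, hrate⟩ := hwidth (n * ε) han
  have : (0 : ℝ) < m := by exact_mod_cast hm
  push_cast at hrate
  have hprob (θ : Fin m → Bool) :
      IsProbabilityMeasure (datumLaw (bumpSum ψ (vertex (L / (m : ℝ) ^ α) θ)) σ) :=
    isProbabilityMeasure_datumLaw hψ.continuous_bumpSum.measurable
  refine le_trans (ENNReal.ofReal_le_ofReal ?_) <|
    le_iSup_mise hψ hBα hm hL.le hLC M fun θ j S hS =>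
      hM.inv_four_le_of_tvLE (tvLE_datumLaw_vertex hψ hσ.ne' hB hL.le (by positivity) hb1 hLσ θ j)
        hε0 hε1 hK hδ ?_ hS
  · rw [mul_assoc]
    gcongr
  · calc (2 + K) * (n * ε) * (2 * b / m ^ (α + 1)) = n * ε / m ^ (α + 1) * (1 / 2) := by
          simp only [b]
          field_simp
          ring
      _ ≤ 1 * (1 / 2) := by
          gcongr
          exact div_le_one_of_le₀ hnm (by positivity)
      _ = 1 / 2 := one_mul _

theorem private_rate_le_sample_rate {n : ℕ} {ε : ℝ} (hn : 0 < n) (hε : 1 ≤ ε) :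
    ((n : ℝ) * ε) ^ (-(2 * (α : ℝ)) / ((α : ℝ) + 1)) ≤
      (n : ℝ) ^ (-(2 * (α : ℝ)) / (2 * (α : ℝ) + 1)) := by
  have hn' : (1 : ℝ) ≤ n := by exact_mod_cast hn
  calc ((n : ℝ) * ε) ^ (-(2 * (α : ℝ)) / ((α : ℝ) + 1))
      ≤ (n : ℝ) ^ (-(2 * (α : ℝ)) / ((α : ℝ) + 1)) :=
        Real.rpow_le_rpow_of_nonpos (by positivity) (le_mul_of_one_le_right (by positivity) hε)
          (div_nonpos_of_nonpos_of_nonneg (by simp) (by positivity))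
    _ ≤ (n : ℝ) ^ (-(2 * (α : ℝ)) / (2 * (α : ℝ) + 1)) := by
        refine Real.rpow_le_rpow_of_exponent_le hn' ?_
        rw [neg_div, neg_div, neg_le_neg_iff]
        gcongr
        linarith [(Nat.cast_nonneg α : (0 : ℝ) ≤ α)]

end Rates

end PrivateRegression

open PrivateRegression in
theorem theorem6p1_general (α : ℕ) {C : ℝ} (hC : 0 < C) {σ : ℝ≥0} (hσ : 0 < σ) {a K : ℝ}
    (ha : 0 < a) (hK : 0 ≤ K) :
    ∃ c' : ℝ, 0 < c' ∧ ∀ (n : ℕ) (ε δ : ℝ), δ ≤ K * ε → a ≤ n * ε →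
      ENNReal.ofReal
          (c' * ((n : ℝ) ^ (-(2 * (α : ℝ)) / (2 * (α : ℝ) + 1)) +
            ((n : ℝ) * ε) ^ (-(2 * (α : ℝ)) / ((α : ℝ) + 1)))) ≤
        minimaxRisk n α C σ ε δ := by
  obtain ⟨c₁, hc₁, sample⟩ := exists_sample_lower_bound α hC hσ
  obtain ⟨c₂, hc₂, privacy⟩ := exists_private_lower_bound α hC hσ ha hK
  refine ⟨min c₁ c₂ / 2, by positivity, fun n ε δ hδ han => le_iInf₂ fun M hM => ?_⟩
  have := hM.1
  have hnε : 0 < n * ε := ha.trans_le han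
  have hε : 0 < ε := pos_of_mul_pos_right hnε (by positivity)
  have hn : 0 < n := by exact_mod_cast pos_of_mul_pos_left hnε hε.le
  have sum_le {c A A' : ℝ} (hc : min c₁ c₂ ≤ c) (hA : 0 ≤ A) (h : A' ≤ 2 * A) :
      min c₁ c₂ / 2 * A' ≤ c * A := by
    nlinarith [mul_le_mul_of_nonneg_right hc hA, lt_min hc₁ hc₂]
  rcases le_total 1 ε with hε1 | hε1
  · refine (ENNReal.ofReal_le_ofReal (sum_le (min_le_left _ _) (by positivity) ?_)).trans
      (sample n M hn)
    linarith [private_rate_le_sample_rate α hn hε1]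
  rcases le_total (((n : ℝ) * ε) ^ (-(2 * (α : ℝ)) / ((α : ℝ) + 1)))
    ((n : ℝ) ^ (-(2 * (α : ℝ)) / (2 * (α : ℝ) + 1))) with h | h
  · refine (ENNReal.ofReal_le_ofReal (sum_le (min_le_left _ _) (by positivity) ?_)).trans
      (sample n M hn)
    linarith
  · refine (ENNReal.ofReal_le_ofReal (sum_le (min_le_right _ _) (by positivity) ?_)).trans
      (privacy n ε δ M hM.2 hε.le hε1 hδ han)
    linarith

theorem theorem6p1 :
    ∃ c : ℝ, 0 < c ∧
      ∀ (α : ℕ) (C : ℝ) (σ : ℝ≥0) (a : ℝ), 1 ≤ α → 0 < C → 0 < σ → 0 < a →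
        ∃ c' : ℝ, 0 < c' ∧
          ∀ (n : ℕ) (ε δ : ℝ), 0 < n → 0 < ε → ε < 1 → 0 < δ → δ < c * ((n : ℝ) ^ 2)⁻¹ →
            a ≤ n * ε →
            ENNReal.ofReal
                (c' * ((n : ℝ) ^ (-(2 * (α : ℝ)) / (2 * (α : ℝ) + 1)) +
                  ((n : ℝ) * ε) ^ (-(2 * (α : ℝ)) / ((α : ℝ) + 1)))) ≤
              PrivateRegression.minimaxRisk n α C σ ε δ := by
  refine ⟨1, one_pos, fun α C σ a _ hC hσ ha => ?_⟩
  obtain ⟨c', hc', bound⟩ := theorem6p1_general α hC hσ ha (K := 1 / a) (by positivity)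
  refine ⟨c', hc', fun n ε δ hn _ _ _ hδ han => bound n ε δ ?_ han⟩
  have hn' : (1 : ℝ) ≤ n := by exact_mod_cast hn
  calc δ ≤ 1 * ((n : ℝ) ^ 2)⁻¹ := hδ.le
    _ ≤ (n : ℝ)⁻¹ := by
        rw [one_mul]
        gcongr
        exact le_self_pow₀ hn' two_ne_zero
    _ = 1 / n := (one_div _).symm
    _ ≤ ε / a := (div_le_div_iff₀ (by positivity) ha).2 (by linarith)
    _ = 1 / a * ε := by ring
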